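/- **Theorem 5.5 (Polyanskiy–Wu, contraction in Bayesian networks).** For a channel (Markov kernel) $P_{Y|X}$ let $$\eta(P_{Y|X})=\sup_{P_X,Q_X}\frac{D(P_Y\,\|\,Q_Y)}{D(P_X\,\|\,Q_X)},\qquad P_Y=P_{Y|X}\circ P_X,\quad Q_Y=P_{Y|X}\circ Q_X,$$ where $D$ is relative entropy and the supremum is over all pairs of probability measures with $0<D(P_X\|Q_X)<\infty$ (the supremum over the empty set is $0$). Let $G=(V,E)$ be a finite directed acyclic graph with exactly one vertex of out-degree zero. Let $X=(X_v)_{v\in V}$ be a Bayesian network with respect to $G$, where $X_v$ takes values in a standard Borel space (for instance, a discrete or an $\mathbb R^n$-valued variable). That is, for each vertex $v$ with set of parents $\mathrm{pa}(v)$ a channel $P_{X_v|X_{\mathrm{pa}(v)}}$ is given, and the joint law of $X$ is $P_X=\prod_{v\in V}P_{X_v|X_{\mathrm{pa}(v)}}$: for every $v$, the conditional law of $X_v$ given all its non-descendants is $P_{X_v|X_{\mathrm{pa}(v)}}$. Let $0\in V$ be a source node, i.e. a vertex without parents, and let $S\subseteq V$. Let $P_{X_S|X_0}$ be the channel obtained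 by stitching together the given channels: it maps a value $x$ to the law of $(X_v)_{v\in S}$ when $X_0$ is set to $x$ and all other variables are generated through their channels $P_{X_v|X_{\mathrm{pa}(v)}}$. Make the vertex $0$ open, and make every other vertex $v$ open with probability $\eta(P_{X_v|X_{\mathrm{pa}(v)}})$, independently of each other. Let $\mathrm{Perc}(0\to S)$ be the probability that there is an open path from $0$ to $S$, that is, a sequence $(v_1,\dots,v_k)$, $k\ge 1$, of distinct open vertices with $v_1=0$, $v_k\in S$ and an edge from $v_i$ to $v_{i+1}$ for each $i<k$. Then $$\eta\left(P_{X_S|X_0}\right)\le \mathrm{Perc}(0\to S).$$ -/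

import Mathlib

open MeasureTheory ProbabilityTheory
open scoped ENNReal

/-- The contraction coefficient `η(P_{Y|X})` of a channel (Markov kernel) `κ = P_{Y|X}`: the supremum
of `D(P_Y ‖ Q_Y) / D(P_X ‖ Q_X)` over all pairs of probability measures `P_X`, `Q_X` with
`0 < D(P_X ‖ Q_X) < ∞`, where `P_Y = P_{Y|X} ∘ P_X` and `Q_Y = P_{Y|X} ∘ Q_X`.
It takes values in `[0, ∞]`, so that the supremum is never a junk value (by the data-processing
inequality it is at most `1`); it is `0` if there are no such pairs. -/
noncomputable def contractionCoeff {𝓧 𝓨 : Type*} [MeasurableSpace 𝓧] [MeasurableSpace 𝓨]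
    (κ : Kernel 𝓧 𝓨) : ℝ≥0∞ :=
  ⨆ (P : Measure 𝓧) (Q : Measure 𝓧) (_ : IsProbabilityMeasure P) (_ : IsProbabilityMeasure Q)
    (_ : 0 < InformationTheory.klDiv P Q) (_ : InformationTheory.klDiv P Q < ∞),
    InformationTheory.klDiv (κ ∘ₘ P) (κ ∘ₘ Q) / InformationTheory.klDiv P Q

/-- The parents of `v` in the directed graph with the edges `Adj`. -/
abbrev parentSet {V : Type*} (Adj : V → V → Prop) (v : V) : Set V := {u | Adj u v}

/-- A Bayesian network with vertex set `V` and alphabets `α v`: a directed acyclic graph (`Adj u v`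
means that there is an edge from `u` to `v`) and, for each vertex `v`, the channel
`P_{X_v | X_pa(v)}`, a Markov kernel from the configurations of the parents of `v` to `α v`.
For a vertex without parents this is just a probability measure on `α v`. -/
structure BayesianNetwork (V : Type*) (α : V → Type*) [∀ v, MeasurableSpace (α v)] where
  /-- the edges of the graph -/
  Adj : V → V → Prop
  /-- there is no directed cycle -/
  acyclic : ∀ v, ¬ Relation.TransGen Adj v v
  /-- the channels `P_{X_v | X_pa(v)}` -/
  channel : ∀ v, Kernel (∀ u : parentSet Adj v, α u) (α v)
  /-- the channels are Markov kernels -/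
  isMarkov : ∀ v, IsMarkovKernel (channel v)

namespace BayesianNetwork

variable {V : Type*} {α : V → Type*} [∀ v, MeasurableSpace (α v)]

instance (B : BayesianNetwork V α) (v : V) : IsMarkovKernel (B.channel v) := B.isMarkov v

/-- The parents of `v`. -/
abbrev pa (B : BayesianNetwork V α) (v : V) : Set V := parentSet B.Adj v

/-- The non-descendants of `v`: the vertices, other than `v` itself, that cannot be reached from `v`
along directed edges. -/
def nonDesc (B : BayesianNetwork V α) (v : V) : Set V :=
  {u | u ≠ v ∧ ¬ Relation.TransGen B.Adj v u}

theorem pa_subset_nonDesc (B : BayesianNetwork V α) (v : V) : B.pa v ⊆ B.nonDesc v := by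
  intro u hu
  refine ⟨?_, fun h => B.acyclic v (h.tail hu)⟩
  rintro rfl
  exact B.acyclic u (Relation.TransGen.single hu)

theorem measurable_domRestrict₂ {s t : Set V} (h : s ⊆ t) :
    Measurable (Set.domRestrict₂ (π := α) h) :=
  measurable_pi_lambda _ fun u => measurable_pi_apply (⟨u.1, h u.2⟩ : t)

theorem measurable_domRestrict (s : Set V) : Measurable (s.domRestrict (π := α)) :=
  measurable_pi_lambda _ fun u => measurable_pi_apply u.1

/-- The channel of `v`, read as a kernel on the configurations of all non-descendants of `v`; it
looks at the parents of `v` only. -/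
noncomputable def channelNonDesc (B : BayesianNetwork V α) (v : V) :
    Kernel (∀ u : B.nonDesc v, α u) (α v) :=
  (B.channel v).comap (Set.domRestrict₂ (π := α) (B.pa_subset_nonDesc v))
    (measurable_domRestrict₂ (B.pa_subset_nonDesc v))

instance (B : BayesianNetwork V α) (v : V) : IsMarkovKernel (B.channelNonDesc v) := by
  exact Kernel.IsMarkovKernel.comap _ _

/-- `μ` is the joint law of a family `X = (X_v)` that is a Bayesian network with the given channels,
that is `P_X = ∏ v, P_{X_v | X_pa(v)}`: for each vertex `v`, the conditional law of `X_v` given all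
its non-descendants depends on its parents only and is given by the channel of `v`. -/
structure IsLaw (B : BayesianNetwork V α) (μ : Measure (∀ v, α v)) : Prop where
  /-- `μ` is a probability measure -/
  isProbabilityMeasure : IsProbabilityMeasure μ
  /-- `X_v` is generated from its non-descendants through the channel of `v` -/
  map_eq : ∀ v, μ.map (fun x => ((B.nonDesc v).domRestrict x, x v)) =
    (μ.map (B.nonDesc v).domRestrict) ⊗ₘ (B.channelNonDesc v)

open Classical in
/-- The Bayesian network in which the variable at `o` is set to the value `a`: the channel of `o`
is replaced by the point mass at `a`, all other channels are kept. -/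
noncomputable def pin (B : BayesianNetwork V α) (o : V) (a : α o) : BayesianNetwork V α where
  Adj := B.Adj
  acyclic := B.acyclic
  channel := Function.update B.channel o (Kernel.const _ (Measure.dirac a))
  isMarkov := by
    intro v
    by_cases h : v = o
    · subst h
      rw [Function.update_self]
      infer_instance
    · rw [Function.update_of_ne h]
      infer_instance

/-- The auxiliary induction behind the existence of stitched kernels: channels that may depend
measurably on a parameter can be composed along the graph. -/
theorem exists_kernel_of_param [Finite V] (B : BayesianNetwork V α) {T : Type*} [MeasurableSpace T]
    (ch : ∀ v, Kernel (T × (∀ u : B.pa v, α u)) (α v)) [∀ v, IsMarkovKernel (ch v)] :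
    ∃ K : Kernel T (∀ v, α v), IsMarkovKernel K ∧ ∀ t v,
      ∀ f : (∀ u : B.nonDesc v, α u) × α v → ℝ≥0∞, Measurable f →
        ∫⁻ x, f ((B.nonDesc v).domRestrict x, x v) ∂(K t) =
          ∫⁻ x, ∫⁻ b, f ((B.nonDesc v).domRestrict x, b) ∂(ch v (t, (B.pa v).domRestrict x)) ∂(K t) := by
  classical
  have hwf : WellFounded (Relation.TransGen B.Adj) :=
    haveI : Std.Irrefl (Relation.TransGen B.Adj) := ⟨B.acyclic⟩
    Finite.wellFounded_of_trans_of_irrefl _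
  have hne : ∀ v, Nonempty (α v) := by
    intro v
    induction v using hwf.induction with
    | _ v ih =>
      have : ∀ u : {u | B.Adj u v}, Nonempty (α u) := fun u => ih u (.single u.2)
      exact (B.channel v (fun u => (this u).some)).nonempty_of_neZero
  let x0 : ∀ v, α v := fun v => (hne v).some
  let good : Set V → Prop := fun D => (∀ v ∈ D, B.pa v ⊆ D) ∧
    ∃ K : Kernel T (∀ v, α v), IsMarkovKernel K ∧ ∀ t, ∀ v ∈ D,
      ∀ f : (∀ u : B.nonDesc v, α u) × α v → ℝ≥0∞, Measurable f →
        ∫⁻ x, f ((B.nonDesc v).domRestrict x, x v) ∂(K t) =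
          ∫⁻ x, ∫⁻ b, f ((B.nonDesc v).domRestrict x, b) ∂(ch v (t, (B.pa v).domRestrict x)) ∂(K t)
  have h0 : good ∅ := ⟨by simp, Kernel.const _ (Measure.dirac x0), inferInstance, by simp⟩
  obtain ⟨D, hD⟩ := (Set.toFinite {D | good D}).exists_maximal ⟨∅, h0⟩
  by_cases hDu : D = Set.univ
  · obtain ⟨-, K, hK, h⟩ := hD.prop
    exact ⟨K, hK, fun t v => h t v (hDu ▸ Set.mem_univ v)⟩
  exfalso
  obtain ⟨w, hwD, hwmin⟩ := hwf.has_min Dᶜ (Set.nonempty_compl.2 hDu)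
  suffices good (insert w D) from
    hwD (hD.le_of_ge this (Set.subset_insert w D) (Set.mem_insert w D))
  obtain ⟨hcl, K, hK, h⟩ := hD.prop
  have hpaw : B.pa w ⊆ D := fun u hu => by
    by_contra hu'
    exact hwmin u hu' (.single hu)
  refine ⟨?_, ?_⟩
  · rintro v (rfl | hv)
    · exact hpaw.trans (Set.subset_insert _ _)
    · exact (hcl v hv).trans (Set.subset_insert _ _)
  -- resample the coordinate `w`
  have hchw : Measurable (fun p : T × (∀ v, α v) => (p.1, (B.pa w).domRestrict p.2)) :=
    measurable_fst.prodMk ((measurable_domRestrict _).comp measurable_snd)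
  let L : Kernel (T × (∀ v, α v)) (α w) := (ch w).comap _ hchw
  have hup : Measurable (fun p : (∀ v, α v) × α w => Function.update p.1 w p.2) := by
    refine measurable_pi_lambda _ fun v => ?_
    by_cases hv : v = w
    · subst hv; simpa using measurable_snd
    · simp only [Function.update_of_ne hv]
      exact (measurable_pi_apply v).comp measurable_fst
  refine ⟨(K ⊗ₖ L).map (fun p => Function.update p.1 w p.2), Kernel.IsMarkovKernel.map _ hup, ?_⟩
  intro t v hv f hf
  have key : ∀ g : (∀ v, α v) → ℝ≥0∞, Measurable g →
      ∫⁻ x, g x ∂((K ⊗ₖ L).map (fun p => Function.update p.1 w p.2) t) =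
        ∫⁻ x, ∫⁻ c, g (Function.update x w c) ∂(ch w (t, (B.pa w).domRestrict x)) ∂(K t) := by
    intro g hg
    rw [Kernel.lintegral_map _ hup _ hg, Kernel.lintegral_compProd _ _ _ (f := fun p => g (Function.update p.1 w p.2)) (hg.comp hup)]
    rfl
  have hrest : ∀ (s : Set V), w ∉ s → ∀ (x : ∀ v, α v) c,
      s.domRestrict (Function.update x w c) = s.domRestrict x := by
    intro s hs x c
    ext u
    have hu : u.1 ≠ w := fun h => hs (h ▸ u.2)
    exact Function.update_of_ne hu _ _
  have hwpa : ∀ v ∈ insert w D, w ∉ B.pa v := by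
    rintro v (rfl | hv) hw
    · exact B.acyclic _ (.single hw)
    · exact hwD (hcl v hv hw)
  have hm1 : Measurable (fun x : ∀ v, α v => f ((B.nonDesc v).domRestrict x, x v)) :=
    hf.comp ((measurable_domRestrict _).prodMk (measurable_pi_apply v))
  have hm2 : Measurable (fun x : ∀ v, α v =>
      ∫⁻ b, f ((B.nonDesc v).domRestrict x, b) ∂(ch v (t, (B.pa v).domRestrict x))) := by
    have hc : Measurable (fun x : ∀ v, α v => (t, (B.pa v).domRestrict x)) :=
      measurable_const.prodMk (measurable_domRestrict _)
    have : Measurable (fun p : (∀ v, α v) × α v => f ((B.nonDesc v).domRestrict p.1, p.2)) :=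
      hf.comp (((measurable_domRestrict _).comp measurable_fst).prodMk measurable_snd)
    exact this.lintegral_kernel_prod_right' (κ := (ch v).comap _ hc)
  rw [key _ hm1, key _ hm2]
  by_cases hvw : v = w
  · subst hvw
    have hn : v ∉ B.nonDesc v := fun hh => hh.1 rfl
    refine lintegral_congr fun x => ?_
    simp [hrest _ hn, hrest _ (hwpa v hv)]
  have hvD : v ∈ D := hv.resolve_left hvw
  by_cases hwn : w ∈ B.nonDesc v
  · have hpan : B.pa w ⊆ B.nonDesc v := by
      intro u hu
      refine ⟨?_, fun hh => hwn.2 (hh.tail hu)⟩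
      rintro rfl
      exact hwn.2 (.single hu)
    -- the update of the coordinate `w` of a configuration of the non-descendants of `v`
    let up : (∀ u : B.nonDesc v, α u) → α w → (∀ u : B.nonDesc v, α u) :=
      fun z c => Function.update z ⟨w, hwn⟩ c
    have hupm : Measurable (fun p : (∀ u : B.nonDesc v, α u) × α w => up p.1 p.2) := by
      refine measurable_pi_lambda _ fun u => ?_
      by_cases hu : u = ⟨w, hwn⟩
      · subst hu; simpa [up] using measurable_snd
      · simp only [up, Function.update_of_ne hu]
        exact (measurable_pi_apply u).comp measurable_fst
    have hupr : ∀ x c, (B.nonDesc v).domRestrict (Function.update x w c) =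
        up ((B.nonDesc v).domRestrict x) c := by
      intro x c
      ext u
      by_cases hu : u = ⟨w, hwn⟩
      · subst hu; simp [up, Set.domRestrict]
      · have : u.1 ≠ w := fun hh => hu (Subtype.ext hh)
        simp [up, Function.update_of_ne hu, Function.update_of_ne this, Set.domRestrict]
    let g : (∀ u : B.nonDesc v, α u) × α v → ℝ≥0∞ := fun p =>
      ∫⁻ c, f (up p.1 c, p.2) ∂(ch w (t, Set.domRestrict₂ (π := α) hpan p.1))
    have hg : Measurable g := by
      have hc : Measurable (fun p : (∀ u : B.nonDesc v, α u) × α v =>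
          (t, Set.domRestrict₂ (π := α) hpan p.1)) :=
        measurable_const.prodMk ((measurable_domRestrict₂ _).comp measurable_fst)
      have : Measurable (fun q : ((∀ u : B.nonDesc v, α u) × α v) × α w =>
          f (up q.1.1 q.2, q.1.2)) :=
        hf.comp ((hupm.comp ((measurable_fst.comp measurable_fst).prodMk measurable_snd)).prodMk
          (measurable_snd.comp measurable_fst))
      exact this.lintegral_kernel_prod_right' (κ := (ch w).comap _ hc)
    have hh := h t v hvD g hg
    simp only [hupr, Function.update_of_ne hvw, hrest _ (hwpa v hv)]
    refine hh.trans (lintegral_congr fun x => ?_)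
    refine lintegral_lintegral_swap (μ := ch v (t, (B.pa v).domRestrict x))
      (ν := ch w (t, (B.pa w).domRestrict x)) (f := fun b c => f (up ((B.nonDesc v).domRestrict x) c, b)) (Measurable.aemeasurable ?_)
    exact hf.comp ((hupm.comp (measurable_const.prodMk measurable_snd)).prodMk measurable_fst)
  · simp only [hrest _ hwn, hrest _ (hwpa v hv), Function.update_of_ne hvw, lintegral_const,
      measure_univ, mul_one]
    exact h t v hvD f hf

/-- There is a Markov kernel that maps each value `a` to the joint law of the network in which the
variable at `o` is set to `a`. -/
theorem exists_stitched [Finite V] (B : BayesianNetwork V α) (o : V) :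
    ∃ K : Kernel (α o) (∀ v, α v), IsMarkovKernel K ∧ ∀ a, (B.pin o a).IsLaw (K a) := by
  classical
  let ch : ∀ v, Kernel (α o × (∀ u : B.pa v, α u)) (α v) := fun v =>
    if hv : v = o then Kernel.deterministic (fun p => hv ▸ p.1) (by subst hv; exact measurable_fst)
    else (B.channel v).comap Prod.snd measurable_snd
  have hch : ∀ v, IsMarkovKernel (ch v) := by
    intro v
    by_cases hv : v = o
    · simp only [ch, dif_pos hv]; infer_instance
    · simp only [ch, dif_neg hv]; exact Kernel.IsMarkovKernel.comap _ _
  have hpin : ∀ a v p, (B.pin o a).channel v p = ch v (a, p) := by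
    intro a v p
    by_cases hv : v = o
    · subst hv
      simp only [ch, pin, dif_pos, Kernel.deterministic_apply, Function.update_self]
      exact Kernel.const_apply _ _
    · simp only [ch, dif_neg hv, pin, Function.update_of_ne hv]
      rfl
  obtain ⟨K, hK, h⟩ := B.exists_kernel_of_param ch
  refine ⟨K, hK, fun a => ⟨inferInstance, fun v => ?_⟩⟩
  have hm : Measurable (fun x : ∀ v, α v => ((B.nonDesc v).domRestrict x, x v)) :=
    (measurable_domRestrict _).prodMk (measurable_pi_apply v)
  change (K a).map (fun x => ((B.nonDesc v).domRestrict x, x v)) =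
    ((K a).map (B.nonDesc v).domRestrict) ⊗ₘ
      (show Kernel (∀ u : B.nonDesc v, α u) (α v) from (B.pin o a).channelNonDesc v)
  refine Measure.ext_of_lintegral _ fun f hf => ?_
  have : IsMarkovKernel (show Kernel (∀ u : B.nonDesc v, α u) (α v) from
    (B.pin o a).channelNonDesc v) := inferInstanceAs (IsMarkovKernel ((B.pin o a).channelNonDesc v))
  rw [lintegral_map hf hm, Measure.lintegral_compProd hf,
    lintegral_map hf.lintegral_kernel_prod_right' (measurable_domRestrict _), h a v f hf]
  refine lintegral_congr fun x => ?_
  exact congrArg (fun m => ∫⁻ b, f ((B.nonDesc v).domRestrict x, b) ∂m)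
    (hpin a v ((B.pa v).domRestrict x)).symm

/-- The kernel `P_{X | X_o}` for a source `o`, obtained by stitching together the channels: it maps
`a` to the joint law of the network in which `X_o` is set to `a` and all other variables are
generated by their channels. (That law is unique, as the vertices can be listed so that each one
comes after its parents.) -/
noncomputable def stitched [Finite V] (B : BayesianNetwork V α) (o : V) :
    Kernel (α o) (∀ v, α v) :=
  (B.exists_stitched o).choose

/-- The kernel `P_{X_S | X_o}`, obtained by stitching together the channels. -/
noncomputable def stitchedOn [Finite V] (B : BayesianNetwork V α) (o : V) (S : Set V) :
    Kernel (α o) (∀ v : S, α v) :=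
  (B.stitched o).map (S.domRestrict (π := α))

/-- In a configuration in which exactly the vertices `v` with `ω v = true` are open, there is an open
path from `T` to `S`: a sequence of `k ≥ 1` distinct open vertices, each one joined to the next by
a directed edge, that starts in `T` and ends in `S`. -/
def HasOpenPath (B : BayesianNetwork V α) (ω : V → Bool) (T S : Set V) : Prop :=
  ∃ (l : List V) (hl : l ≠ []), l.Nodup ∧ l.IsChain B.Adj ∧ l.head hl ∈ T ∧ l.getLast hl ∈ S ∧
    ∀ v ∈ l, ω v = true

open Classical in
/-- The probability that `v` is open: the contraction coefficient of its channel, except that the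
vertex `o`, from which the percolation starts, is always open. -/
noncomputable def openProb (B : BayesianNetwork V α) (o v : V) : ℝ≥0∞ :=
  if v = o then 1 else contractionCoeff (B.channel v)

/-- The law of the random configuration in which the vertices are open independently of each other,
`v` with probability `B.openProb o v`. -/
noncomputable def percMeasure [Fintype V] (B : BayesianNetwork V α) (o : V) :
    Measure (V → Bool) :=
  Measure.pi fun v =>
    B.openProb o v • Measure.dirac true + (1 - B.openProb o v) • Measure.dirac false

/-- The percolation probability from `o` to `S`: the probability of an open path from `o` to `S`. -/
noncomputable def perc [Fintype V] (B : BayesianNetwork V α) (o : V) (S : Set V) : ℝ≥0∞ :=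
  B.percMeasure o {ω | B.HasOpenPath ω {o} S}

end BayesianNetwork

/-!
The bound is proved by revealing the observed variables one at a time, and the percolation
probability obeys the recursion that this produces.

Let `w ≠ o` be a vertex and `A ∌ w` a set of vertices, none of them a descendant of `w`. Given
`X_A`, the variable `X_w` is generated from `X_pa(w)` by the channel of `w`, and this under both
initial laws. Hence the chain rule for relative entropy (`klDiv_compProd_eq_add`), together with the
strong data processing inequality for the channel of `w` applied conditionally on `X_A`, gives
`D(A ∪ {w}) ≤ η_w D(A ∪ pa(w)) + (1 - η_w) D(A)`, where `D(T)` is the relative entropy of the two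
laws of `X_T`. This is `klDiv_id_parallelComp_comp_le` for abstract spaces and
`IsLawAwayFrom.klDiv_map_insert_le` in the network; it uses that the conditional relative entropy is
the average of the relative entropies of the fibres (`klDiv_compProd_right`).

Conditioning on the state of `w` gives
`Perc(A ∪ {w}) ≥ η_w Perc(A ∪ pa(w)) + (1 - η_w) Perc(A)` (`le_perc_insert`): if `w` is open, a path
to a parent of `w` extends to `w`. So `D(S) ≤ Perc(S) D(P ‖ Q)` follows by induction along a
topological order (`IsLawAwayFrom.klDiv_map_le_perc_mul`): both `A ∪ pa(w)` and `A` avoid `w` and all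
its descendants. The induction stops when `S` is empty, or when `o ∈ S`; in the latter case
`Perc(S) = 1` and the bound is the ordinary data processing inequality.
-/

/-! ### Strong data processing -/

namespace InformationTheory

section Contraction

variable {𝓧 𝓨 𝓩 : Type*} [MeasurableSpace 𝓧] [MeasurableSpace 𝓨] [MeasurableSpace 𝓩]

lemma rnDeriv_compProd_right [MeasurableSpace.CountableOrCountablyGenerated 𝓧 𝓨]
    {μ : Measure 𝓧} [IsFiniteMeasure μ] {κ η : Kernel 𝓧 𝓨} [IsFiniteKernel κ] [IsFiniteKernel η]
    (h : ∀ᵐ x ∂μ, κ x ≪ η x) :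
    (μ ⊗ₘ κ).rnDeriv (μ ⊗ₘ η) =ᵐ[μ ⊗ₘ η] fun p => κ.rnDeriv η p.1 p.2 := by
  have hm := Kernel.measurable_rnDeriv κ η
  have hκ : μ ⊗ₘ κ = (μ ⊗ₘ η).withDensity (fun p => κ.rnDeriv η p.1 p.2) := by
    rw [← Measure.compProd_withDensity hm]
    refine Measure.compProd_congr ?_
    filter_upwards [h] with x hx using (Kernel.withDensity_rnDeriv_eq hx).symm
  rw [hκ]
  exact Measure.rnDeriv_withDensity _ hm

/-- The relative entropy of two kernels, in terms of their jointly measurable density. -/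
lemma klDiv_kernel_ae_eq [MeasurableSpace.CountableOrCountablyGenerated 𝓧 𝓨]
    {μ : Measure 𝓧} {κ η : Kernel 𝓧 𝓨} [IsFiniteKernel κ] [IsFiniteKernel η]
    (h : ∀ᵐ x ∂μ, κ x ≪ η x) :
    (fun x => klDiv (κ x) (η x)) =ᵐ[μ]
      fun x => ∫⁻ y, ENNReal.ofReal (klFun (κ.rnDeriv η x y).toReal) ∂(η x) := by
  filter_upwards [h] with x hx
  rw [klDiv_eq_lintegral_klFun_of_ac hx]
  refine lintegral_congr_ae ?_
  filter_upwards [Kernel.rnDeriv_eq_rnDeriv_measure (κ := κ) (η := η) (a := x)] with y hy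
  rw [hy]

lemma aemeasurable_klDiv_kernel [MeasurableSpace.CountableOrCountablyGenerated 𝓧 𝓨]
    {μ : Measure 𝓧} {κ η : Kernel 𝓧 𝓨} [IsFiniteKernel κ] [IsFiniteKernel η]
    (h : ∀ᵐ x ∂μ, κ x ≪ η x) : AEMeasurable (fun x => klDiv (κ x) (η x)) μ := by
  have hm : Measurable fun p : 𝓧 × 𝓨 => κ.rnDeriv η p.1 p.2 := Kernel.measurable_rnDeriv κ η
  have hm' : Measurable fun p : 𝓧 × 𝓨 => ENNReal.ofReal (klFun (κ.rnDeriv η p.1 p.2).toReal) :=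
    (measurable_klFun.comp hm.ennreal_toReal).ennreal_ofReal
  exact hm'.lintegral_kernel_prod_right'.aemeasurable.congr (klDiv_kernel_ae_eq h).symm

/-- The conditional relative entropy is the average of the relative entropies of the fibres. -/
lemma klDiv_compProd_right [MeasurableSpace.CountableOrCountablyGenerated 𝓧 𝓨]
    {μ : Measure 𝓧} [IsFiniteMeasure μ] {κ η : Kernel 𝓧 𝓨} [IsMarkovKernel κ] [IsMarkovKernel η]
    (h : ∀ᵐ x ∂μ, κ x ≪ η x) :
    klDiv (μ ⊗ₘ κ) (μ ⊗ₘ η) = ∫⁻ x, klDiv (κ x) (η x) ∂μ := by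
  have hm : Measurable fun p : 𝓧 × 𝓨 => κ.rnDeriv η p.1 p.2 := Kernel.measurable_rnDeriv κ η
  rw [klDiv_eq_lintegral_klFun_of_ac (Measure.absolutelyContinuous_compProd_right_iff.2 h)]
  calc ∫⁻ p, ENNReal.ofReal (klFun ((μ ⊗ₘ κ).rnDeriv (μ ⊗ₘ η) p).toReal) ∂(μ ⊗ₘ η)
  _ = ∫⁻ p, ENNReal.ofReal (klFun (κ.rnDeriv η p.1 p.2).toReal) ∂(μ ⊗ₘ η) := by
    refine lintegral_congr_ae ?_
    filter_upwards [rnDeriv_compProd_right h] with p hp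
    rw [hp]
  _ = ∫⁻ x, ∫⁻ y, ENNReal.ofReal (klFun (κ.rnDeriv η x y).toReal) ∂(η x) ∂μ :=
    Measure.lintegral_compProd (measurable_klFun.comp hm.ennreal_toReal).ennreal_ofReal
  _ = ∫⁻ x, klDiv (κ x) (η x) ∂μ := lintegral_congr_ae (klDiv_kernel_ae_eq h).symm

lemma contractionCoeff_le_one (κ : Kernel 𝓧 𝓨) [IsMarkovKernel κ] : contractionCoeff κ ≤ 1 := by
  refine iSup_le fun P => iSup_le fun Q => iSup_le fun _ => iSup_le fun _ => iSup_le fun _ =>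
    iSup_le fun _ => ?_
  exact ENNReal.div_le_of_le_mul (by simpa using klDiv_comp_right_le P Q κ)

/-- Strong data processing. Finiteness of `klDiv P Q` matters when `contractionCoeff κ = 0`, as
`0 * ∞ = 0`. -/
lemma klDiv_comp_le_contractionCoeff_mul (κ : Kernel 𝓧 𝓨) [IsMarkovKernel κ] (P Q : Measure 𝓧)
    [IsProbabilityMeasure P] [IsProbabilityMeasure Q] (h : klDiv P Q ≠ ∞) :
    klDiv (κ ∘ₘ P) (κ ∘ₘ Q) ≤ contractionCoeff κ * klDiv P Q := by
  rcases eq_or_ne (klDiv P Q) 0 with h0 | h0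
  · simpa [h0] using klDiv_comp_right_le P Q κ
  · rw [← ENNReal.div_le_iff h0 h]
    exact le_iSup_of_le P <| le_iSup_of_le Q <| le_iSup_of_le ‹_› <| le_iSup_of_le ‹_› <|
      le_iSup_of_le (pos_iff_ne_zero.2 h0) <| le_iSup_of_le h.lt_top le_rfl

/-- Passing the second component of a pair through a channel: the relative entropy of the result is
at most a mixture of that of the whole pair and that of the first component alone. This is the
chain rule, combined with strong data processing conditionally on the first component. -/
lemma klDiv_id_parallelComp_comp_le [StandardBorelSpace 𝓨] [StandardBorelSpace 𝓩]
    (κ : Kernel 𝓨 𝓩) [IsMarkovKernel κ] (μ ν : Measure (𝓧 × 𝓨))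
    [IsProbabilityMeasure μ] [IsProbabilityMeasure ν] (h : klDiv μ ν ≠ ∞) :
    klDiv (((Kernel.id : Kernel 𝓧 𝓧) ∥ₖ κ) ∘ₘ μ) (((Kernel.id : Kernel 𝓧 𝓧) ∥ₖ κ) ∘ₘ ν) ≤
      contractionCoeff κ * klDiv μ ν + (1 - contractionCoeff κ) * klDiv μ.fst ν.fst := by
  have : Nonempty 𝓨 := (nonempty_of_isProbabilityMeasure μ).map Prod.snd
  have hμ : μ = μ.fst ⊗ₘ μ.condKernel := (μ.disintegrate μ.condKernel).symm
  have hν : ν = ν.fst ⊗ₘ ν.condKernel := (ν.disintegrate ν.condKernel).symm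
  have hchain : klDiv μ ν = klDiv μ.fst ν.fst +
      klDiv (μ.fst ⊗ₘ μ.condKernel) (μ.fst ⊗ₘ ν.condKernel) := by
    conv_lhs => rw [hμ, hν]
    exact klDiv_compProd_eq_add _ _ _ _
  have hcond : klDiv (μ.fst ⊗ₘ μ.condKernel) (μ.fst ⊗ₘ ν.condKernel) ≠ ∞ :=
    ne_top_of_le_ne_top h (hchain ▸ le_add_self)
  have hac : ∀ᵐ x ∂μ.fst, μ.condKernel x ≪ ν.condKernel x :=
    Measure.absolutelyContinuous_compProd_right_iff.1 (klDiv_ne_top_iff.1 hcond).1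
  have hint := klDiv_compProd_right hac
  have hac' : ∀ᵐ x ∂μ.fst, (κ ∘ₖ μ.condKernel) x ≪ (κ ∘ₖ ν.condKernel) x := by
    filter_upwards [hac] with x hx
    rw [Kernel.comp_apply, Kernel.comp_apply]
    exact hx.comp_right κ
  have hfin : ∀ᵐ x ∂μ.fst, klDiv (μ.condKernel x) (ν.condKernel x) < ∞ :=
    ae_lt_top' (aemeasurable_klDiv_kernel hac) (hint ▸ hcond)
  have hstep : klDiv (μ.fst ⊗ₘ (κ ∘ₖ μ.condKernel)) (μ.fst ⊗ₘ (κ ∘ₖ ν.condKernel)) ≤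
      contractionCoeff κ * klDiv (μ.fst ⊗ₘ μ.condKernel) (μ.fst ⊗ₘ ν.condKernel) := by
    rw [klDiv_compProd_right hac', hint, ← lintegral_const_mul' _ _
      ((contractionCoeff_le_one κ).trans_lt ENNReal.one_lt_top).ne]
    refine lintegral_mono_ae ?_
    filter_upwards [hfin] with x hx
    rw [Kernel.comp_apply, Kernel.comp_apply]
    exact klDiv_comp_le_contractionCoeff_mul κ _ _ hx.ne
  have hη : contractionCoeff κ + (1 - contractionCoeff κ) = 1 :=
    add_tsub_cancel_of_le (contractionCoeff_le_one κ)
  calc klDiv (((Kernel.id : Kernel 𝓧 𝓧) ∥ₖ κ) ∘ₘ μ) (((Kernel.id : Kernel 𝓧 𝓧) ∥ₖ κ) ∘ₘ ν)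
  _ = klDiv (μ.fst ⊗ₘ (κ ∘ₖ μ.condKernel)) (ν.fst ⊗ₘ (κ ∘ₖ ν.condKernel)) := by
    conv_lhs => rw [hμ, hν, Measure.parallelComp_comp_compProd, Measure.parallelComp_comp_compProd]
  _ = klDiv μ.fst ν.fst +
      klDiv (μ.fst ⊗ₘ (κ ∘ₖ μ.condKernel)) (μ.fst ⊗ₘ (κ ∘ₖ ν.condKernel)) :=
    klDiv_compProd_eq_add _ _ _ _
  _ ≤ (contractionCoeff κ + (1 - contractionCoeff κ)) * klDiv μ.fst ν.fst +
      contractionCoeff κ * klDiv (μ.fst ⊗ₘ μ.condKernel) (μ.fst ⊗ₘ ν.condKernel) := by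
    rw [hη, one_mul]
    gcongr
  _ = _ := by rw [hchain]; ring

end Contraction

end InformationTheory

namespace BayesianNetwork

open InformationTheory

variable {V : Type*} {α : V → Type*} [∀ v, MeasurableSpace (α v)]

/-! ### Percolation -/

section Percolation

lemma openProb_le_one (B : BayesianNetwork V α) (o v : V) : B.openProb o v ≤ 1 := by
  unfold openProb
  split_ifs
  · exact le_rfl
  · exact contractionCoeff_le_one _

instance isProbabilityMeasure_openLaw (B : BayesianNetwork V α) (o v : V) :
    IsProbabilityMeasure
      (B.openProb o v • Measure.dirac true + (1 - B.openProb o v) • Measure.dirac false) :=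
  ⟨by simp [add_tsub_cancel_of_le (B.openProb_le_one o v)]⟩

open Classical in
/-- Integrating over the state of the single vertex `w` first. -/
lemma lintegral_percMeasure [Fintype V] (B : BayesianNetwork V α) (o w : V)
    (f : (V → Bool) → ℝ≥0∞) :
    ∫⁻ ω, f ω ∂B.percMeasure o = ∫⁻ ω, (B.openProb o w * f (Function.update ω w true) +
      (1 - B.openProb o w) * f (Function.update ω w false)) ∂B.percMeasure o := by
  refine lintegral_eq_of_lmarginal_eq {w} (measurable_of_countable _) (measurable_of_countable _) ?_
  ext ω
  rw [lmarginal_singleton, lmarginal_singleton]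
  simp only [Function.update_idem, lintegral_const, measure_univ, mul_one]
  simp [lintegral_add_measure, lintegral_smul_measure]

open Classical in
/-- If `w ∉ A` has no descendants in `A`, then an open path to `A` does not visit `w`, and an open
path to a parent of `w` can be prolonged to `w` when `w` is open. -/
lemma le_perc_insert [Fintype V] (B : BayesianNetwork V α) {o w : V} {A : Set V} (hwA : w ∉ A)
    (hdesc : ∀ v ∈ A, ¬ Relation.TransGen B.Adj w v) :
    B.openProb o w * B.perc o (A ∪ B.pa w) + (1 - B.openProb o w) * B.perc o A ≤
      B.perc o (insert w A) := by
  have hperc : ∀ T : Set V, B.perc o T =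
      ∫⁻ ω, Set.indicator {ω | B.HasOpenPath ω {o} T} 1 ω ∂B.percMeasure o := fun T =>
    (lintegral_indicator_one (Set.toFinite _).measurableSet).symm
  -- a path that visits `w` ends in `w` or in a descendant of `w`
  have hlast : ∀ (l : List V) (hl : l ≠ []), l.IsChain B.Adj → w ∈ l →
      Relation.ReflTransGen B.Adj w (l.getLast hl) := by
    intro l hl hc hw
    obtain ⟨s, t, rfl⟩ := List.append_of_mem hw
    rw [List.getLast_append_of_ne_nil _ (List.cons_ne_nil w t)]
    exact List.relationReflTransGen_of_exists_isChain_cons t (List.isChain_append.1 hc).2.1 rfl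
  have htrue : ∀ ω, B.HasOpenPath ω {o} (A ∪ B.pa w) →
      B.HasOpenPath (Function.update ω w true) {o} (insert w A) := by
    rintro ω ⟨l, hl, hnd, hc, hh, hlA | hlp, hop⟩
    · refine ⟨l, hl, hnd, hc, hh, Or.inr hlA, fun v hv => ?_⟩
      by_cases hvw : v = w <;> simp [hvw, Function.update_of_ne, hop v hv]
    · have hwl : w ∉ l := fun hw => B.acyclic w
        (Relation.TransGen.tail' (hlast l hl hc hw) hlp)
      refine ⟨l ++ [w], by simp, ?_, ?_, ?_, by simp, fun v hv => ?_⟩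
      · simpa [List.nodup_append] using ⟨hnd, fun a ha haw => hwl (by rwa [← haw])⟩
      · refine List.isChain_append.2 ⟨hc, List.isChain_singleton w, ?_⟩
        intro x hx y hy
        rw [List.getLast?_eq_some_getLast hl, Option.mem_some_iff] at hx
        simp only [List.head?_cons, Option.mem_some_iff] at hy
        subst hx hy
        exact hlp
      · rwa [List.head_append_of_ne_nil hl]
      · by_cases hvw : v = w
        · simp [hvw]
        · rw [Function.update_of_ne hvw]
          exact hop v (by simpa [hvw] using hv)
  have hfalse : ∀ ω, B.HasOpenPath ω {o} A →
      B.HasOpenPath (Function.update ω w false) {o} (insert w A) := by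
    rintro ω ⟨l, hl, hnd, hc, hh, hlA, hop⟩
    have hwl : w ∉ l := by
      intro hw
      rcases (Relation.reflTransGen_iff_eq_or_transGen.1 (hlast l hl hc hw)) with h | h
      · exact hwA (h ▸ hlA)
      · exact hdesc _ hlA h
    refine ⟨l, hl, hnd, hc, hh, Or.inr hlA, fun v hv => ?_⟩
    rw [Function.update_of_ne (ne_of_mem_of_not_mem hv hwl)]
    exact hop v hv
  have hind : ∀ {s t : Set (V → Bool)} {ω ω' : V → Bool}, (ω ∈ s → ω' ∈ t) →
      s.indicator (1 : (V → Bool) → ℝ≥0∞) ω ≤ t.indicator 1 ω' := by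
    intro s t ω ω' hst
    by_cases hω : ω ∈ s
    · simp [hω, hst hω]
    · simp [hω]
  rw [hperc (insert w A), B.lintegral_percMeasure o w, hperc, hperc,
    ← lintegral_const_mul _ (measurable_of_countable _),
    ← lintegral_const_mul _ (measurable_of_countable _),
    ← lintegral_add_left (measurable_of_countable _)]
  refine lintegral_mono fun ω => ?_
  dsimp only
  gcongr
  · exact hind (htrue ω)
  · exact hind (hfalse ω)

lemma one_le_perc [Fintype V] (B : BayesianNetwork V α) {o : V} {S : Set V} (hoS : o ∈ S) :
    1 ≤ B.perc o S := by
  classical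
  have h1 : B.openProb o o = 1 := if_pos rfl
  have hpath : ∀ ω, B.HasOpenPath (Function.update ω o true) {o} S := fun ω =>
    ⟨[o], by simp, by simp, by simp, by simp, by simpa using hoS, by simp⟩
  have : IsProbabilityMeasure (B.percMeasure o) := by unfold percMeasure; infer_instance
  rw [perc, ← lintegral_indicator_one (Set.toFinite _).measurableSet, B.lintegral_percMeasure o o]
  simp [h1, hpath]

end Percolation

/-! ### Laws of the network -/

section Law

/-- `μ` generates every `X_v`, `v ≠ o`, from the non-descendants of `v` through the channel of `v`;
the law of `X_o` is free. -/
def IsLawAwayFrom (B : BayesianNetwork V α) (o : V) (μ : Measure (∀ v, α v)) : Prop :=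
  ∀ v, v ≠ o → ∀ f : (∀ u : B.nonDesc v, α u) × α v → ℝ≥0∞, Measurable f →
    ∫⁻ x, f ((B.nonDesc v).domRestrict x, x v) ∂μ =
      ∫⁻ x, ∫⁻ b, f ((B.nonDesc v).domRestrict x, b) ∂(B.channel v ((B.pa v).domRestrict x)) ∂μ

lemma isMarkovKernel_stitched [Finite V] (B : BayesianNetwork V α) (o : V) :
    IsMarkovKernel (B.stitched o) :=
  (B.exists_stitched o).choose_spec.1

lemma isLaw_stitched [Finite V] (B : BayesianNetwork V α) (o : V) (a : α o) :
    (B.pin o a).IsLaw (B.stitched o a) :=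
  (B.exists_stitched o).choose_spec.2 a

lemma isLawAwayFrom_stitched [Finite V] (B : BayesianNetwork V α) (o : V) (a : α o) :
    B.IsLawAwayFrom o (B.stitched o a) := by
  classical
  intro v hv f hf
  have := B.isMarkovKernel_stitched o
  have hm : Measurable (fun x : ∀ v, α v => ((B.nonDesc v).domRestrict x, x v)) :=
    (measurable_domRestrict _).prodMk (measurable_pi_apply v)
  have h : (B.stitched o a).map (fun x => ((B.nonDesc v).domRestrict x, x v)) =
      ((B.stitched o a).map (B.nonDesc v).domRestrict) ⊗ₘ
        (show Kernel (∀ u : B.nonDesc v, α u) (α v) from (B.pin o a).channelNonDesc v) :=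
    (B.isLaw_stitched o a).map_eq v
  have : IsMarkovKernel (show Kernel (∀ u : B.nonDesc v, α u) (α v) from
    (B.pin o a).channelNonDesc v) := inferInstanceAs (IsMarkovKernel ((B.pin o a).channelNonDesc v))
  rw [← lintegral_map hf hm, h, Measure.lintegral_compProd hf,
    lintegral_map hf.lintegral_kernel_prod_right' (measurable_domRestrict _)]
  refine lintegral_congr fun x => ?_
  refine congrArg (fun m => ∫⁻ b, f ((B.nonDesc v).domRestrict x, b) ∂m) ?_
  change (Function.update B.channel o (Kernel.const _ (Measure.dirac a)) v)
    ((B.pa v).domRestrict x) = _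
  rw [Function.update_of_ne hv]

lemma IsLawAwayFrom.comp {B : BayesianNetwork V α} {o : V} {T : Type*}
    [MeasurableSpace T] {K : Kernel T (∀ v, α v)} (hK : ∀ t, B.IsLawAwayFrom o (K t))
    (P : Measure T) : B.IsLawAwayFrom o (K ∘ₘ P) := by
  intro v hv f hf
  have hm : Measurable (fun p : (∀ v, α v) × α v => f ((B.nonDesc v).domRestrict p.1, p.2)) :=
    hf.comp (((measurable_domRestrict _).comp measurable_fst).prodMk measurable_snd)
  rw [Measure.lintegral_bind (f := fun x => f ((B.nonDesc v).domRestrict x, x v)) K.aemeasurable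
      (hf.comp ((measurable_domRestrict _).prodMk (measurable_pi_apply v))).aemeasurable,
    Measure.lintegral_bind
      (f := fun x => ∫⁻ b, f ((B.nonDesc v).domRestrict x, b)
        ∂(B.channel v ((B.pa v).domRestrict x))) K.aemeasurable
      (hm.lintegral_kernel_prod_right'
        (κ := (B.channel v).comap _ (measurable_domRestrict _))).aemeasurable]
  exact lintegral_congr fun t => hK t v hv f hf

/-- If all of `A` are non-descendants of `w`, then `(X_A, X_w)` arises from `(X_A, X_pa(w))` by
passing the second component through the channel of `w`. -/
lemma IsLawAwayFrom.map_pair {B : BayesianNetwork V α} {o w : V} {μ : Measure (∀ v, α v)}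
    (hμ : B.IsLawAwayFrom o μ) (hwo : w ≠ o) {A : Set V} (hA : A ⊆ B.nonDesc w) :
    μ.map (fun x => (A.domRestrict x, x w)) =
      (Kernel.id ∥ₖ B.channel w) ∘ₘ
        (μ.map (fun x => (A.domRestrict x, (B.pa w).domRestrict x))) := by
  refine Measure.ext_of_lintegral _ fun f hf => ?_
  have hf' : Measurable fun p : (∀ u : B.nonDesc w, α u) × α w =>
      f (Set.domRestrict₂ (π := α) hA p.1, p.2) :=
    hf.comp (((measurable_domRestrict₂ hA).comp measurable_fst).prodMk measurable_snd)
  rw [lintegral_map hf ((measurable_domRestrict _).prodMk (measurable_pi_apply w)),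
    Measure.lintegral_bind (Kernel.aemeasurable _) hf.aemeasurable,
    lintegral_map hf.lintegral_kernel
      ((measurable_domRestrict _).prodMk (measurable_domRestrict _))]
  refine (hμ w hwo _ hf').trans (lintegral_congr fun x => ?_)
  rw [Kernel.parallelComp_apply, Kernel.id_apply, lintegral_prod _ hf.aemeasurable,
    lintegral_dirac' _ hf.lintegral_prod_right']
  rfl

variable [∀ v, StandardBorelSpace (α v)] [Finite V]

/-- Adding a vertex `w` without descendants in `A` to the observed variables. -/
lemma IsLawAwayFrom.klDiv_map_insert_le {B : BayesianNetwork V α} {o w : V}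
    {μ ν : Measure (∀ v, α v)} [IsProbabilityMeasure μ] [IsProbabilityMeasure ν]
    (hμ : B.IsLawAwayFrom o μ) (hν : B.IsLawAwayFrom o ν) (h : klDiv μ ν ≠ ∞) (hwo : w ≠ o)
    {A : Set V} (hA : A ⊆ B.nonDesc w) :
    klDiv (μ.map ((insert w A).domRestrict (π := α))) (ν.map ((insert w A).domRestrict (π := α))) ≤
      contractionCoeff (B.channel w) *
        klDiv (μ.map ((A ∪ B.pa w).domRestrict (π := α)))
          (ν.map ((A ∪ B.pa w).domRestrict (π := α))) +
      (1 - contractionCoeff (B.channel w)) *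
        klDiv (μ.map (A.domRestrict (π := α))) (ν.map (A.domRestrict (π := α))) := by
  classical
  have hpair : Measurable fun x : ∀ v, α v => (A.domRestrict x, (B.pa w).domRestrict x) :=
    (measurable_domRestrict _).prodMk (measurable_domRestrict _)
  have hpw : Measurable fun x : ∀ v, α v => (A.domRestrict x, x w) :=
    (measurable_domRestrict _).prodMk (measurable_pi_apply w)
  -- data processing along `e : (x_A, x_w) ↦ x_{A ∪ {w}}` and `g : x_{A ∪ pa(w)} ↦ (x_A, x_pa(w))`
  -- turns laws on unions into laws of pairs; `A` and `pa(w)` may overlap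
  let e : (∀ u : A, α u) × α w → ∀ u : (insert w A : Set V), α u := fun p u =>
    if hu : u.1 = w then cast (congrArg α hu.symm) p.2 else p.1 ⟨u.1, u.2.resolve_left hu⟩
  have he : Measurable e := by
    refine measurable_pi_lambda _ fun u => ?_
    obtain ⟨u, hu⟩ := u
    by_cases huw : u = w
    · subst huw
      simpa [e] using measurable_snd
    · simp only [e, huw, dif_neg, not_false_eq_true]
      exact (measurable_pi_apply (⟨u, hu.resolve_left huw⟩ : A)).comp measurable_fst
  have hins : (insert w A).domRestrict (π := α) = e ∘ fun x => (A.domRestrict x, x w) := by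
    ext x ⟨u, hu⟩
    by_cases huw : u = w
    · subst huw
      simp [e]
    · simp [e, huw]
  let g : (∀ u : (A ∪ B.pa w : Set V), α u) → (∀ u : A, α u) × (∀ u : B.pa w, α u) := fun y =>
    (Set.domRestrict₂ (π := α) Set.subset_union_left y,
      Set.domRestrict₂ (π := α) Set.subset_union_right y)
  have hg : Measurable g := (measurable_domRestrict₂ _).prodMk (measurable_domRestrict₂ _)
  have hfst : ∀ ξ : Measure (∀ v, α v),
      (ξ.map fun x => (A.domRestrict x, (B.pa w).domRestrict x)).fst = ξ.map A.domRestrict :=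
    fun ξ => Measure.fst_map_prodMk (measurable_domRestrict _)
  have := Measure.isProbabilityMeasure_map (μ := μ) hpair.aemeasurable
  have := Measure.isProbabilityMeasure_map (μ := ν) hpair.aemeasurable
  calc _ ≤ klDiv (μ.map (fun x => (A.domRestrict x, x w)))
        (ν.map (fun x => (A.domRestrict x, x w))) := by
        rw [hins, ← Measure.map_map he hpw, ← Measure.map_map he hpw]
        exact klDiv_map_le _ _ he
    _ ≤ contractionCoeff (B.channel w) *
          klDiv (μ.map fun x => (A.domRestrict x, (B.pa w).domRestrict x))
            (ν.map fun x => (A.domRestrict x, (B.pa w).domRestrict x)) +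
        (1 - contractionCoeff (B.channel w)) *
          klDiv (μ.map A.domRestrict) (ν.map A.domRestrict) := by
        rw [hμ.map_pair hwo hA, hν.map_pair hwo hA, ← hfst μ, ← hfst ν]
        exact klDiv_id_parallelComp_comp_le _ _ _ (ne_top_of_le_ne_top h (klDiv_map_le _ _ hpair))
    _ ≤ _ := by
        gcongr
        have hcomp : (fun x : ∀ v, α v => (A.domRestrict x, (B.pa w).domRestrict x)) =
            g ∘ (A ∪ B.pa w).domRestrict (π := α) := rfl
        rw [hcomp, ← Measure.map_map hg (measurable_domRestrict _),
          ← Measure.map_map hg (measurable_domRestrict _)]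
        exact klDiv_map_le _ _ hg

end Law

/-! ### Induction along the graph -/

/-- The bound for laws of the whole network, by induction on a set `D` that contains the parents of
its vertices. -/
lemma IsLawAwayFrom.klDiv_map_le_perc_mul [Fintype V] [∀ v, StandardBorelSpace (α v)]
    {B : BayesianNetwork V α} {o : V}
    {μ ν : Measure (∀ v, α v)} [IsProbabilityMeasure μ] [IsProbabilityMeasure ν]
    (hμ : B.IsLawAwayFrom o μ) (hν : B.IsLawAwayFrom o ν) (h : klDiv μ ν ≠ ∞)
    (D : Finset V) (hD : ∀ v ∈ D, B.pa v ⊆ D) (S : Set V) (hS : S ⊆ D) :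
    klDiv (μ.map (S.domRestrict (π := α))) (ν.map (S.domRestrict (π := α))) ≤
      B.perc o S * klDiv μ ν := by
  classical
  induction D using Finset.strongInduction generalizing S with
  | H D ih =>
  by_cases hoS : o ∈ S
  · calc _ ≤ klDiv μ ν := klDiv_map_le _ _ (measurable_domRestrict _)
      _ ≤ _ := le_mul_of_one_le_left' (B.one_le_perc hoS)
  rcases D.eq_empty_or_nonempty with rfl | hne
  · have hS0 : IsEmpty S := Set.isEmpty_coe_sort.2 (by simpa using hS)
    have heq : μ.map (S.domRestrict (π := α)) = ν.map (S.domRestrict (π := α)) := by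
      have := Measure.isProbabilityMeasure_map (μ := μ)
        (measurable_domRestrict (α := α) S).aemeasurable
      have := Measure.isProbabilityMeasure_map (μ := ν)
        (measurable_domRestrict (α := α) S).aemeasurable
      ext s -
      rcases Set.eq_empty_or_nonempty s with rfl | hs
      · simp
      · rw [Subsingleton.eq_univ_of_nonempty hs, measure_univ, measure_univ]
    have := Measure.isFiniteMeasure_map ν (S.domRestrict (π := α))
    rw [heq, klDiv_self]
    exact zero_le
  -- a vertex of `D` without descendants in `D`
  obtain ⟨w, hwD, hwmax⟩ : ∃ w ∈ D, ∀ v ∈ D, ¬ Relation.TransGen B.Adj w v := by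
    have : Std.Irrefl (Relation.TransGen B.Adj) := ⟨B.acyclic⟩
    have hwf := Finite.wellFounded_of_trans_of_irrefl (Function.swap (Relation.TransGen B.Adj))
    obtain ⟨w, hw, hmax⟩ := hwf.has_min (D : Set V) hne
    exact ⟨w, hw, fun v hv => hmax v hv⟩
  have herase : ∀ T : Set V, T ⊆ D → w ∉ T →
      klDiv (μ.map (T.domRestrict (π := α))) (ν.map (T.domRestrict (π := α))) ≤
        B.perc o T * klDiv μ ν := by
    intro T hT hwT
    refine ih (D.erase w) (Finset.erase_ssubset hwD) (fun v hv u hu => ?_) T fun u hu => ?_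
    · rw [Finset.mem_erase] at hv
      have huD := hD v hv.2 hu
      refine Finset.mem_coe.2 (Finset.mem_erase.2 ⟨?_, huD⟩)
      rintro rfl
      exact hwmax v hv.2 (.single hu)
    · refine Finset.mem_coe.2 (Finset.mem_erase.2 ⟨?_, hT hu⟩)
      rintro rfl
      exact hwT hu
  by_cases hwS : w ∈ S
  swap
  · exact herase S hS hwS
  have hwo : w ≠ o := fun hh => hoS (hh ▸ hwS)
  obtain ⟨A, hwA, rfl⟩ : ∃ A : Set V, w ∉ A ∧ S = insert w A :=
    ⟨S \ {w}, by simp, by simp [hwS]⟩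
  have hAD : A ⊆ D := (Set.subset_insert w A).trans hS
  have hdesc : ∀ v ∈ A, ¬ Relation.TransGen B.Adj w v := fun v hv => hwmax v (hAD hv)
  have hA : A ⊆ B.nonDesc w := fun v hv => ⟨fun hh => hwA (hh ▸ hv), hdesc v hv⟩
  have hwpa : w ∉ A ∪ B.pa w := by
    rintro (hw | hw)
    · exact hwA hw
    · exact B.acyclic w (.single hw)
  have hop : B.openProb o w = contractionCoeff (B.channel w) := if_neg hwo
  calc _ ≤ _ := hμ.klDiv_map_insert_le hν h hwo hA
    _ ≤ contractionCoeff (B.channel w) * (B.perc o (A ∪ B.pa w) * klDiv μ ν) +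
        (1 - contractionCoeff (B.channel w)) * (B.perc o A * klDiv μ ν) := by
      gcongr
      · exact herase _ (Set.union_subset hAD (hD w hwD)) hwpa
      · exact herase _ hAD hwA
    _ = (B.openProb o w * B.perc o (A ∪ B.pa w) + (1 - B.openProb o w) * B.perc o A) *
        klDiv μ ν := by rw [hop]; ring
    _ ≤ _ := by
      gcongr
      exact B.le_perc_insert hwA hdesc

end BayesianNetwork

open InformationTheory in
theorem theorem5p5 {V : Type*} [Fintype V] {α : V → Type*}
    [∀ v, MeasurableSpace (α v)] [∀ v, StandardBorelSpace (α v)]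
    (B : BayesianNetwork V α)
    (hsink : ∃! w : V, ∀ v, ¬ B.Adj w v)
    (o : V) (ho : ∀ u, ¬ B.Adj u o)
    (S : Set V) :
    contractionCoeff (B.stitchedOn o S) ≤ B.perc o S := by
  refine iSup_le fun P => iSup_le fun Q => iSup_le fun _ => iSup_le fun _ => iSup_le fun _ =>
    iSup_le fun hfin => ?_
  have := B.isMarkovKernel_stitched o
  have hdpi : klDiv (B.stitched o ∘ₘ P) (B.stitched o ∘ₘ Q) ≤ klDiv P Q :=
    klDiv_comp_right_le P Q _
  have hmap : ∀ R : Measure (α o), B.stitchedOn o S ∘ₘ R =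
      (B.stitched o ∘ₘ R).map (S.domRestrict (π := α)) := fun R =>
    (Measure.map_comp R _ (BayesianNetwork.measurable_domRestrict S)).symm
  refine ENNReal.div_le_of_le_mul ?_
  rw [hmap, hmap]
  refine (BayesianNetwork.IsLawAwayFrom.klDiv_map_le_perc_mul
    (BayesianNetwork.IsLawAwayFrom.comp (B.isLawAwayFrom_stitched o) P)
    (BayesianNetwork.IsLawAwayFrom.comp (B.isLawAwayFrom_stitched o) Q)
    (hdpi.trans_lt hfin).ne Finset.univ (by simp) S (by simp)).trans ?_
  gcongr
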